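/- For $n\ge 0$ let $\gamma_1,\dots,\gamma_{2n}$ be the Majorana operators on $\mathbb{C}^{2^n}$ in the Weyl--Brauer representation, $\gamma_{2k-1}=Z^{\otimes(k-1)}\otimes X\otimes \mathbb I^{\otimes(n-k)}$ and $\gamma_{2k}=Z^{\otimes(k-1)}\otimes Y\otimes \mathbb I^{\otimes(n-k)}$. For $I=\{i_1<i_2<i_3<i_4\}\subseteq[2n]$ let $\gamma_I=\gamma_{i_1}\gamma_{i_2}\gamma_{i_3}\gamma_{i_4}$. For $p\in(0,1]$ the sparse SYK Hamiltonian is $$H_{\mathrm{SSYK}}(p)=\binom{2n}{4}^{-1/2}p^{-1/2}\,i^{2}\sum_{I\subseteq[2n],\,|I|=4}J_I X_I\gamma_I ,$$ where all the variables $J_I,X_I$ are independent, the $J_I$ are standard Gaussian, and $\mathbb P(X_I=1)=p=1-\mathbb P(X_I=0)$ (for $n\le 1$ the sum is empty and $H_{\mathrm{SSYK}}(p)=0$). A state is a density matrix $\rho$ on $\mathbb{C}^{2^n}$ (pure states are included), and it achieves energy $t$ if $\operatorname{Tr}(H_{\mathrm{SSYK}}(p)\rho)\ge t$. **Proposition (sparse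 SYK circuit complexity lower bound).** There is an absolute constant $c>0$ such that for all $n$, all $p\in(0,1]$, every family $S$ of states that is fixed before the Hamiltonian is drawn, and every $s\ge 0$, the following holds with probability at least $1-e^{-cs}$ over the draw of $H_{\mathrm{SSYK}}(p)$: for every $t\ge 0$ with $pn^2t^2\ge s$, if $S$ contains a state which achieves energy $t$, then $$|S|\ \ge\ \exp\left(c\,p\,n^2t^2\right).$$ In particular, taking $s=n^{a}$ for a constant $a>0$, with probability exponentially close to $1$ (at least $1-e^{-cn^{a}}$), if $S$ contains a state which achieves an energy $t\ge 0$ with $pn^2t^2\ge n^{a}$, then $S$ has at least $\exp(\Omega(pn^2t^2))$ distinct states. -/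

import Mathlib

open MeasureTheory ProbabilityTheory
open scoped Matrix ComplexOrder ENNReal

noncomputable section

namespace SparseSYK

/-- The Pauli matrix `X`. -/
def pauliX : Matrix (Fin 2) (Fin 2) ℂ := !![0, 1; 1, 0]

/-- The Pauli matrix `Y`. -/
def pauliY : Matrix (Fin 2) (Fin 2) ℂ := !![0, -Complex.I; Complex.I, 0]

/-- The Pauli matrix `Z`. -/
def pauliZ : Matrix (Fin 2) (Fin 2) ℂ := !![1, 0; 0, -1]

/-- Computational basis labels of `n` qubits; operators on the `2 ^ n`-dimensional space are
square matrices with rows and columns indexed by these labels. -/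
abbrev Basis (n : ℕ) : Type := Fin n → Fin 2

/-- The tensor product `A 0 ⊗ A 1 ⊗ ⋯ ⊗ A (n - 1)` of one-qubit operators. -/
def tensor {n : ℕ} (A : Fin n → Matrix (Fin 2) (Fin 2) ℂ) : Matrix (Basis n) (Basis n) ℂ :=
  Matrix.of fun x y => ∏ k, A k (x k) (y k)

/-- The `2 n` Majorana operators in the Weyl--Brauer (Jordan--Wigner) representation. With indices
starting at `0`, operator `2 k` is `Z ⊗ ⋯ ⊗ Z ⊗ X ⊗ 1 ⊗ ⋯ ⊗ 1` and operator `2 k + 1` is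
`Z ⊗ ⋯ ⊗ Z ⊗ Y ⊗ 1 ⊗ ⋯ ⊗ 1`, with the `X` or `Y` at qubit `k`. -/
def majorana {n : ℕ} (j : Fin (2 * n)) : Matrix (Basis n) (Basis n) ℂ :=
  tensor fun k =>
    if (k : ℕ) < (j : ℕ) / 2 then pauliZ
    else if (k : ℕ) = (j : ℕ) / 2 then (if (j : ℕ) % 2 = 0 then pauliX else pauliY)
    else 1

/-- `γ_I = γ_{i₁} ⋯ γ_{i_q}` for `I = {i₁ < ⋯ < i_q}`. -/
def majoranaProd {n : ℕ} (I : Finset (Fin (2 * n))) : Matrix (Basis n) (Basis n) ℂ :=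
  ((I.sort (· ≤ ·)).map majorana).prod

/-- The four-element subsets of the `2 n` Majorana indices. -/
abbrev Quad (n : ℕ) : Type := {I : Finset (Fin (2 * n)) // I.card = 4}

/-- The sparse SYK (degree 4) Hamiltonian
`binom(2n, 4)^(-1/2) p^(-1/2) i² ∑_I J_I X_I γ_I` for given couplings `J` and indicators `X`. -/
def hamiltonian (n : ℕ) (p : ℝ) (J X : Quad n → ℝ) : Matrix (Basis n) (Basis n) ℂ :=
  (((√((2 * n).choose 4 : ℝ))⁻¹ * (√p)⁻¹ : ℝ) : ℂ) •
    Complex.I ^ 2 • ∑ I : Quad n, ((J I * X I : ℝ) : ℂ) • majoranaProd I.1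

/-- The joint law of the disorder `(J, X)`: all the variables are independent, each `J I` is a
standard Gaussian, and each `X I` is `1` with probability `p` and `0` with probability `1 - p`. -/
def disorderLaw (n : ℕ) (p : unitInterval) : Measure ((Quad n → ℝ) × (Quad n → ℝ)) :=
  (Measure.pi fun _ => gaussianReal 0 1).prod (Measure.pi fun _ => bernoulliMeasure 1 0 p)

/-- (Possibly mixed) quantum states of `n` fermionic modes, as density matrices. -/
def IsState {n : ℕ} (ρ : Matrix (Basis n) (Basis n) ℂ) : Prop :=
  ρ.PosSemidef ∧ ρ.trace = 1

/-- The energy `Tr (H ρ)`, which is real when `H` and `ρ` are Hermitian. -/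
def energy {n : ℕ} (H ρ : Matrix (Basis n) (Basis n) ℂ) : ℝ := (H * ρ).trace.re

end SparseSYK

end

/-!
For a fixed state `ρ` and fixed indicators `X`, the energy is a centred Gaussian in the couplings,
with variance at most `(p * binom(2n, 4))⁻¹ ∑_I (Re Tr (γ_I ρ)) ^ 2`. The point is that the
expectations of the `≈ n ^ 4` quartic monomials cannot be large at once: their squares sum to
`O(n ^ 2)` (`sum_sq_quartic_le`), because most pairs of monomials anticommute. Hence the variance is
`O(1 / (p n ^ 2))`, the energy exceeds `t` with probability at most `exp (-2 c p n ^ 2 t ^ 2)`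
(`disorderLaw_energy_ge_le`), and a union bound over `S` at the smallest `t` for which both
`s ≤ p n ^ 2 t ^ 2` and `log |S| ≤ c p n ^ 2 t ^ 2` gives the theorem.

The bound on the quartic expectations is proved for any positive unital functional `φ` and any
family of `m` self-adjoint Clifford generators, by lowering the degree. With coefficients
`a = φ(γ_i γ_j γ_k γ_l)`, the sum of squares is `∑ φ(γ_i T_i)` for antisymmetric cubic forms `T_i`,
so Cauchy--Schwarz reduces it to `φ(T_i⋆ T_i)`. The square of a cubic form is, up to an additive
scalar of favourable sign, nine times the sum of the squares of its quadratic contractions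
(`IsCliffordFamily.cubicForm_mul_self`); it is this identity that avoids a loss of a factor `m`.
A quadratic form is a sum of `m` terms `γ_j R_j`, with `R_j` linear and `R_j ^ 2` a scalar, and
Cauchy--Schwarz finishes.
-/

namespace SparseSYK

/-! ### Forms in Clifford generators -/

section Clifford

variable {ι A : Type*} [Ring A] [Algebra ℝ A]

/-- A family of generators of a Clifford algebra: distinct members anticommute, and each member
squares to `1`. -/
def IsCliffordFamily [DecidableEq ι] (γ : ι → A) : Prop :=
  ∀ i j, γ i * γ j = (if i = j then (2 : ℝ) else 0) • (1 : A) - γ j * γ i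

theorem IsCliffordFamily.mul_self [DecidableEq ι] {γ : ι → A} (hγ : IsCliffordFamily γ)
    (i : ι) : γ i * γ i = 1 := by
  have h := hγ i i
  rw [if_pos rfl, eq_sub_iff_add_eq, ← two_smul ℝ] at h
  exact smul_right_injective A (two_ne_zero (α := ℝ)) h

variable [Fintype ι]

/-- The linear form `∑ c i γ i`. -/
def linForm (γ : ι → A) (c : ι → ℝ) : A := ∑ i, c i • γ i

/-- The quadratic form `∑ c i j γ i γ j`; the sum is over all pairs `(i, j)`, with
`i > j` and `i = j` included. -/
def quadForm (γ : ι → A) (c : ι → ι → ℝ) : A := ∑ i, γ i * linForm γ (c i)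

/-- The cubic form `∑ c i j k γ i γ j γ k`; the sum is over all triples `(i, j, k)`, with
repetitions and in any order. -/
def cubicForm (γ : ι → A) (c : ι → ι → ι → ℝ) : A := ∑ i, γ i * quadForm γ (c i)

theorem linForm_neg (γ : ι → A) (c : ι → ℝ) : linForm γ (fun i => -c i) = -linForm γ c := by
  simp [linForm]

theorem quadForm_eq_sum (γ : ι → A) (c : ι → ι → ℝ) :
    quadForm γ c = ∑ i, ∑ j, c i j • (γ i * γ j) := by
  simp only [quadForm, linForm, Finset.mul_sum, mul_smul_comm]

theorem cubicForm_eq_sum (γ : ι → A) (c : ι → ι → ι → ℝ) :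
    cubicForm γ c = ∑ i, ∑ j, ∑ k, c i j k • (γ i * γ j * γ k) := by
  simp only [cubicForm, quadForm_eq_sum, Finset.mul_sum, mul_smul_comm, mul_assoc]

variable [DecidableEq ι] {γ : ι → A}

theorem IsCliffordFamily.mul_linForm (hγ : IsCliffordFamily γ) (c : ι → ℝ) (i : ι) :
    γ i * linForm γ c = (2 * c i) • (1 : A) - linForm γ c * γ i := by
  simp only [linForm, Finset.mul_sum, Finset.sum_mul, mul_smul_comm, smul_mul_assoc]
  rw [Finset.sum_congr rfl fun j _ => by rw [hγ i j, smul_sub, smul_smul], Finset.sum_sub_distrib]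
  simp [mul_comm]

theorem IsCliffordFamily.linForm_mul_self (hγ : IsCliffordFamily γ) (c : ι → ℝ) :
    linForm γ c * linForm γ c = (∑ i, c i ^ 2) • (1 : A) := by
  have h : linForm γ c * linForm γ c
      = (2 * ∑ i, c i ^ 2) • (1 : A) - linForm γ c * linForm γ c := by
    calc linForm γ c * linForm γ c = ∑ i, c i • (γ i * linForm γ c) := by
          simp only [← smul_mul_assoc, ← Finset.sum_mul]
          rfl
      _ = ∑ i, ((2 * c i ^ 2) • (1 : A) - linForm γ c * c i • γ i) := by
          refine Finset.sum_congr rfl fun i _ => ?_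
          rw [hγ.mul_linForm, smul_sub, smul_smul, mul_smul_comm]
          ring_nf
      _ = _ := by
          simp only [Finset.sum_sub_distrib, Finset.mul_sum, Finset.sum_smul, linForm]
  rw [eq_sub_iff_add_eq, ← two_smul ℝ, mul_smul] at h
  exact smul_right_injective A (two_ne_zero (α := ℝ)) h

/-- The commutator of a generator with an antisymmetric quadratic form is four times its
contraction. -/
theorem IsCliffordFamily.mul_quadForm (hγ : IsCliffordFamily γ) {c : ι → ι → ℝ}
    (hc : ∀ i j, c i j = -c j i) (i : ι) :
    γ i * quadForm γ c = quadForm γ c * γ i + (4 : ℝ) • linForm γ (c i) := by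
  have h1 : ∑ j, (2 * c j i) • γ j = -((2 : ℝ) • linForm γ (c i)) := by
    simp only [linForm, Finset.smul_sum, ← Finset.sum_neg_distrib, smul_smul]
    exact Finset.sum_congr rfl fun j _ => by rw [hc j i, mul_neg, neg_smul]
  have h2 : ∑ j, (if i = j then (2 : ℝ) else 0) • linForm γ (c j)
      = (2 : ℝ) • linForm γ (c i) := by simp
  calc γ i * quadForm γ c
      = ∑ j, ((if i = j then (2 : ℝ) else 0) • linForm γ (c j)
          - ((2 * c j i) • γ j - γ j * linForm γ (c j) * γ i)) := by
        rw [quadForm, Finset.mul_sum]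
        refine Finset.sum_congr rfl fun j _ => ?_
        rw [← mul_assoc, hγ i j, sub_mul, smul_mul_assoc, one_mul, mul_assoc (γ j),
          hγ.mul_linForm, mul_sub, mul_smul_comm, mul_one, ← mul_assoc]
    _ = quadForm γ c * γ i + (4 : ℝ) • linForm γ (c i) := by
        rw [Finset.sum_sub_distrib, Finset.sum_sub_distrib, h1, h2, ← Finset.sum_mul, ← quadForm]
        module

/-- The anticommutator of a generator with an antisymmetric cubic form is six times its
contraction. -/
theorem IsCliffordFamily.mul_cubicForm (hγ : IsCliffordFamily γ) {c : ι → ι → ι → ℝ}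
    (hc₁ : ∀ i j k, c i j k = -c j i k) (hc₂ : ∀ i j k, c i j k = -c i k j) (i : ι) :
    γ i * cubicForm γ c = (6 : ℝ) • quadForm γ (c i) - cubicForm γ c * γ i := by
  have h1 : ∑ j, γ j * ((4 : ℝ) • linForm γ (c j i)) = -((4 : ℝ) • quadForm γ (c i)) := by
    rw [quadForm, Finset.smul_sum, ← Finset.sum_neg_distrib]
    refine Finset.sum_congr rfl fun j _ => ?_
    rw [show c j i = fun k => -c i j k from funext fun k => hc₁ j i k, linForm_neg, smul_neg,
      mul_neg, mul_smul_comm]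
  have h2 : ∑ j, (if i = j then (2 : ℝ) else 0) • quadForm γ (c j)
      = (2 : ℝ) • quadForm γ (c i) := by simp
  calc γ i * cubicForm γ c
      = ∑ j, ((if i = j then (2 : ℝ) else 0) • quadForm γ (c j)
          - (γ j * quadForm γ (c j) * γ i + γ j * ((4 : ℝ) • linForm γ (c j i)))) := by
        rw [cubicForm, Finset.mul_sum]
        refine Finset.sum_congr rfl fun j _ => ?_
        rw [← mul_assoc, hγ i j, sub_mul, smul_mul_assoc, one_mul, mul_assoc (γ j),
          hγ.mul_quadForm (hc₂ j), mul_add, ← mul_assoc]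
    _ = (6 : ℝ) • quadForm γ (c i) - cubicForm γ c * γ i := by
        rw [Finset.sum_sub_distrib, Finset.sum_add_distrib, h1, h2, ← Finset.sum_mul, ← cubicForm]
        module

/-- The square of an antisymmetric cubic form is, up to an additive scalar, a multiple of the sum
of the squares of its contractions: products of two cubic monomials sharing no index or two
indices cancel, because they anticommute, and those sharing one index are collected by the
contraction over it. -/
theorem IsCliffordFamily.cubicForm_mul_self (hγ : IsCliffordFamily γ) {c : ι → ι → ι → ℝ}
    (hc₁ : ∀ i j k, c i j k = -c j i k) (hc₂ : ∀ i j k, c i j k = -c i k j) :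
    cubicForm γ c * cubicForm γ c
      = (9 : ℝ) • ∑ i, quadForm γ (c i) * quadForm γ (c i)
        + (12 * ∑ i, ∑ j, ∑ k, c i j k ^ 2) • (1 : A) := by
  set T := cubicForm γ c with hT
  set Q := fun i => quadForm γ (c i) with hQ
  set R := fun i j => linForm γ (c i j) with hR
  have hTγ : ∀ i, T * γ i = (6 : ℝ) • Q i - γ i * T := fun i => by
    rw [hT, hγ.mul_cubicForm hc₁ hc₂]; simp only [hQ]; abel
  have hRneg : ∀ i j, R i j = -R j i := fun i j => by
    simp only [hR]
    rw [← linForm_neg]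
    exact congrArg _ (funext fun k => hc₁ i j k)
  have hQsum : ∀ i, Q i = ∑ j, γ j * R i j := fun i => rfl
  have hTR : ∀ i j, T * R i j = (6 : ℝ) • ∑ k, c i j k • Q k - R i j * T := fun i j => by
    simp only [hR, linForm, Finset.mul_sum, mul_smul_comm, hTγ, Finset.sum_mul, smul_mul_assoc,
      Finset.smul_sum, smul_sub, Finset.sum_sub_distrib]
    congr 1
    exact Finset.sum_congr rfl fun k _ => smul_comm _ _ _
  have hS₁ : ∑ i, ∑ j, γ i * (γ j * ∑ k, c i j k • Q k) = ∑ k, Q k * Q k := by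
    have : ∀ k, Q k * Q k = ∑ i, ∑ j, γ i * (γ j * (c i j k • Q k)) := fun k => by
      conv_lhs =>
        enter [1]
        rw [hQ]
      simp only [quadForm_eq_sum, Finset.sum_mul]
      refine Finset.sum_congr rfl fun i _ => Finset.sum_congr rfl fun j _ => ?_
      rw [hc₁ k i j, hc₂ i k j, neg_neg, smul_mul_assoc, mul_smul_comm, mul_smul_comm, mul_assoc]
    simp only [this, Finset.mul_sum]
    exact (Finset.sum_congr rfl fun i _ => Finset.sum_comm).trans Finset.sum_comm
  have hS₂ : ∑ i, ∑ j, γ i * (Q j * R i j)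
      = -∑ k, Q k * Q k - (4 * ∑ i, ∑ j, ∑ k, c i j k ^ 2) • (1 : A) := by
    have : ∀ i j, γ i * (Q j * R i j)
        = -(Q j * (γ i * R j i)) - (4 * ∑ k, c j i k ^ 2) • (1 : A) := fun i j => by
      have h : γ i * Q j = Q j * γ i + (4 : ℝ) • R j i := hγ.mul_quadForm (hc₂ j) i
      rw [← mul_assoc, h, hRneg i j, add_mul, mul_neg, mul_neg, smul_mul_assoc]
      simp only [hR]
      rw [hγ.linForm_mul_self, smul_smul, mul_assoc]
      abel
    simp only [this]
    rw [Finset.sum_comm]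
    simp only [Finset.sum_sub_distrib, Finset.sum_neg_distrib, ← Finset.mul_sum, ← hQsum,
      ← Finset.sum_smul]
  have hcub : ∑ i, ∑ j, γ i * (γ j * (R i j * T)) = T * T := by
    simp only [← mul_assoc, ← Finset.sum_mul]
    simp only [mul_assoc, ← Finset.mul_sum, ← hQsum]
    rfl
  -- Moving `T` to the right past the two generators in `Q i` produces `T * T` again, and
  -- contractions.
  have hTQ : ∑ i, γ i * (T * Q i)
      = (-12 : ℝ) • ∑ k, Q k * Q k - (24 * ∑ i, ∑ j, ∑ k, c i j k ^ 2) • (1 : A) + T * T := by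
    have : ∀ i, γ i * (T * Q i) = ∑ j, ((6 : ℝ) • (γ i * (Q j * R i j))
        - ((6 : ℝ) • (γ i * (γ j * ∑ k, c i j k • Q k)) - γ i * (γ j * (R i j * T)))) :=
      fun i => by
      rw [hQsum i, Finset.mul_sum, Finset.mul_sum]
      refine Finset.sum_congr rfl fun j _ => ?_
      rw [← mul_assoc T, hTγ, sub_mul, mul_assoc (γ j), hTR, smul_mul_assoc, mul_sub, mul_sub,
        mul_sub, mul_smul_comm, mul_smul_comm, mul_smul_comm]
    simp only [this, Finset.sum_sub_distrib, ← Finset.smul_sum, hS₁, hS₂, hcub]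
    module
  have hmain : T * T = (6 : ℝ) • ∑ k, Q k * Q k - ∑ i, γ i * (T * Q i) := by
    conv_lhs =>
      enter [2]
      rw [hT, cubicForm]
    rw [Finset.mul_sum, Finset.smul_sum, ← Finset.sum_sub_distrib]
    refine Finset.sum_congr rfl fun i _ => ?_
    rw [← mul_assoc, hTγ, sub_mul, smul_mul_assoc, mul_assoc]
  rw [hTQ] at hmain
  have h2 : (2 : ℝ) • (T * T) = (2 : ℝ) • ((9 : ℝ) • ∑ i, Q i * Q i
        + (12 * ∑ i, ∑ j, ∑ k, c i j k ^ 2) • (1 : A)) := by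
    rw [two_smul]
    nth_rw 1 [hmain]
    module
  exact smul_right_injective A (two_ne_zero (α := ℝ)) h2

end Clifford

/-! ### Quartic correlations of a positive functional -/

section Correlations

variable {ι A : Type*} [Fintype ι] [Ring A] [StarRing A] [Algebra ℝ A] {γ : ι → A}

/-- Cauchy--Schwarz for a sum, in the seminorm of a positive functional. -/
theorem map_star_sum_mul_sum_le (φ : A →ₗ[ℝ] ℝ) (hφ : ∀ x, 0 ≤ φ (star x * x)) (x : ι → A) :
    φ (star (∑ i, x i) * ∑ i, x i) ≤ Fintype.card ι * ∑ i, φ (star (x i) * x i) := by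
  have h : 0 ≤ ∑ i, ∑ j, φ (star (x i - x j) * (x i - x j)) :=
    Finset.sum_nonneg fun i _ => Finset.sum_nonneg fun j _ => hφ _
  have h1 : ∑ i, ∑ j, φ (star (x i) * x j) = φ (star (∑ i, x i) * ∑ i, x i) := by
    simp only [star_sum, Finset.sum_mul, Finset.mul_sum, map_sum]
    exact Finset.sum_comm
  have h2 : ∑ i, ∑ j, φ (star (x j) * x i) = φ (star (∑ i, x i) * ∑ i, x i) := by
    rw [← h1, Finset.sum_comm]
  simp only [star_sub, sub_mul, mul_sub, map_sub, Finset.sum_sub_distrib, h1, h2,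
    Finset.sum_const, Finset.card_univ, nsmul_eq_mul, ← Finset.mul_sum] at h
  linarith

variable [StarModule ℝ A]

theorem star_quadForm (hs : ∀ i, star (γ i) = γ i) {c : ι → ι → ℝ}
    (hc : ∀ i j, c i j = -c j i) : star (quadForm γ c) = -quadForm γ c := by
  simp only [quadForm_eq_sum, star_sum, star_smul, star_mul, hs, star_trivial,
    ← Finset.sum_neg_distrib]
  rw [Finset.sum_comm]
  refine Finset.sum_congr rfl fun j _ => Finset.sum_congr rfl fun i _ => ?_
  rw [hc i j, neg_smul]

theorem star_cubicForm (hs : ∀ i, star (γ i) = γ i) {c : ι → ι → ι → ℝ}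
    (hc₁ : ∀ i j k, c i j k = -c j i k) (hc₂ : ∀ i j k, c i j k = -c i k j) :
    star (cubicForm γ c) = -cubicForm γ c := by
  simp only [cubicForm_eq_sum, star_sum, star_smul, star_mul, hs, star_trivial,
    ← Finset.sum_neg_distrib]
  calc ∑ i, ∑ j, ∑ k, c i j k • (γ k * (γ j * γ i))
      = ∑ i, ∑ k, ∑ j, c i j k • (γ k * (γ j * γ i)) :=
        Finset.sum_congr rfl fun i _ => Finset.sum_comm
    _ = ∑ k, ∑ i, ∑ j, c i j k • (γ k * (γ j * γ i)) := Finset.sum_comm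
    _ = ∑ k, ∑ j, ∑ i, c i j k • (γ k * (γ j * γ i)) :=
        Finset.sum_congr rfl fun k _ => Finset.sum_comm
    _ = _ := by
        refine Finset.sum_congr rfl fun k _ => Finset.sum_congr rfl fun j _ =>
          Finset.sum_congr rfl fun i _ => ?_
        rw [hc₁ i j k, hc₂ j i k, hc₁ j k i, neg_neg, neg_smul, mul_assoc]

variable [DecidableEq ι] {φ : A →ₗ[ℝ] ℝ}

theorem map_star_quadForm_mul_self_le (hγ : IsCliffordFamily γ) (hs : ∀ i, star (γ i) = γ i)
    (hφ : ∀ x, 0 ≤ φ (star x * x)) (hφ₁ : φ 1 = 1) (c : ι → ι → ℝ) :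
    φ (star (quadForm γ c) * quadForm γ c) ≤ Fintype.card ι * ∑ i, ∑ j, c i j ^ 2 := by
  refine (map_star_sum_mul_sum_le φ hφ _).trans_eq ?_
  congr 1
  refine Finset.sum_congr rfl fun i _ => ?_
  have h : star (linForm γ (c i)) = linForm γ (c i) := by simp [linForm, hs]
  rw [star_mul, hs, h, mul_assoc, ← mul_assoc (γ i), hγ.mul_self, one_mul, hγ.linForm_mul_self,
    map_smul, hφ₁, smul_eq_mul, mul_one]

/-- Antisymmetric forms of degree two and three are skew-adjoint, so the square identity bounds
`T⋆ T` by the `Q⋆ Q` and drops a nonpositive scalar. -/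
theorem map_star_cubicForm_mul_self_le (hγ : IsCliffordFamily γ) (hs : ∀ i, star (γ i) = γ i)
    (hφ : ∀ x, 0 ≤ φ (star x * x)) (hφ₁ : φ 1 = 1) {c : ι → ι → ι → ℝ}
    (hc₁ : ∀ i j k, c i j k = -c j i k) (hc₂ : ∀ i j k, c i j k = -c i k j) :
    φ (star (cubicForm γ c) * cubicForm γ c)
      ≤ 9 * Fintype.card ι * ∑ i, ∑ j, ∑ k, c i j k ^ 2 := by
  have hQ : ∀ i, -φ (quadForm γ (c i) * quadForm γ (c i))
      ≤ Fintype.card ι * ∑ j, ∑ k, c i j k ^ 2 := fun i => by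
    have h := map_star_quadForm_mul_self_le hγ hs hφ hφ₁ (c i)
    rwa [star_quadForm hs (hc₂ i), neg_mul, map_neg] at h
  have h := Finset.sum_le_sum fun i (_ : i ∈ Finset.univ) => hQ i
  rw [Finset.sum_neg_distrib, ← Finset.mul_sum] at h
  have h0 : 0 ≤ ∑ i, ∑ j, ∑ k, c i j k ^ 2 := by positivity
  rw [star_cubicForm hs hc₁ hc₂, neg_mul, map_neg, hγ.cubicForm_mul_self hc₁ hc₂]
  simp only [map_add, map_smul, map_sum, hφ₁, smul_eq_mul]
  linarith

/-- The quartic correlations of a positive functional have total square mass quadratic, rather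
than quartic, in the number of generators. -/
theorem sum_sq_quartic_le (hγ : IsCliffordFamily γ) (hs : ∀ i, star (γ i) = γ i)
    (hφ : ∀ x, 0 ≤ φ (star x * x)) (hφ₁ : φ 1 = 1)
    (hφs : ∀ x, φ (star x) = φ x) {a : ι → ι → ι → ι → ℝ}
    (ha₁ : ∀ i j k l, a i j k l = -a i k j l) (ha₂ : ∀ i j k l, a i j k l = -a i j l k)
    (ha : ∀ i j k l, a i j k l = 0 ∨ a i j k l = φ (γ i * γ j * γ k * γ l)) :
    ∑ i, ∑ j, ∑ k, ∑ l, a i j k l ^ 2 ≤ 9 * (Fintype.card ι : ℝ) ^ 2 := by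
  set S := ∑ i, ∑ j, ∑ k, ∑ l, a i j k l ^ 2 with hS
  set m : ℝ := (Fintype.card ι : ℝ) with hm
  have hSφ : S = ∑ i, φ (γ i * cubicForm γ (a i)) := by
    rw [hS]
    refine Finset.sum_congr rfl fun i _ => ?_
    simp only [cubicForm_eq_sum, Finset.mul_sum, map_sum, mul_smul_comm, map_smul, smul_eq_mul]
    refine Finset.sum_congr rfl fun j _ => Finset.sum_congr rfl fun k _ =>
      Finset.sum_congr rfl fun l _ => ?_
    rcases ha i j k l with h | h
    · simp [h]
    · rw [sq]
      nth_rw 2 [h]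
      simp only [mul_assoc]
  -- Positivity at `r γ i - T i`, with `r` to be optimised.
  have hi : ∀ (r : ℝ) i, 2 * r * φ (γ i * cubicForm γ (a i))
      ≤ r ^ 2 + 9 * m * ∑ j, ∑ k, ∑ l, a i j k l ^ 2 := fun r i => by
    have h1 := map_star_cubicForm_mul_self_le hγ hs hφ hφ₁ (ha₁ i) (ha₂ i)
    have h2 := hφ (r • γ i - cubicForm γ (a i))
    have h3 : φ (star (cubicForm γ (a i)) * γ i) = φ (γ i * cubicForm γ (a i)) := by
      rw [← hφs, star_mul, hs, star_star]
    simp only [star_sub, star_smul, star_trivial, hs, sub_mul, mul_sub, smul_mul_assoc,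
      mul_smul_comm, hγ.mul_self, map_sub, map_smul, hφ₁, h3, smul_eq_mul] at h2
    linarith
  have hr : ∀ r : ℝ, 2 * r * S ≤ m * r ^ 2 + 9 * m * S := fun r => by
    rw [hSφ, Finset.mul_sum, ← hSφ]
    refine (Finset.sum_le_sum fun i _ => hi r i).trans_eq ?_
    rw [Finset.sum_add_distrib, ← Finset.mul_sum, Finset.sum_const, Finset.card_univ,
      nsmul_eq_mul]
  rcases isEmpty_or_nonempty ι with hι | hι
  · simp [hS, hm]
  · have hm0 : 0 < m := by
      rw [hm]
      exact_mod_cast Fintype.card_pos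
    -- This choice of `r` leaves half of the left-hand side after absorbing `9 * m * S`.
    have h := hr (9 * m)
    refine le_of_mul_le_mul_left ?_ hm0
    linarith

end Correlations

/-! ### The Majorana operators -/

theorem tensor_mul {n : ℕ} (A B : Fin n → Matrix (Fin 2) (Fin 2) ℂ) :
    tensor A * tensor B = tensor fun k => A k * B k := by
  ext x y
  simp only [tensor, Matrix.mul_apply, Matrix.of_apply, ← Finset.prod_mul_distrib,
    Finset.prod_univ_sum, Fintype.piFinset_univ]

theorem tensor_one {n : ℕ} : tensor (fun _ : Fin n => 1) = 1 := by
  ext x y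
  simp only [tensor, Matrix.of_apply, Matrix.one_apply, Finset.prod_ite_zero, funext_iff]
  simp

theorem tensor_smul {n : ℕ} (c : Fin n → ℂ) (A : Fin n → Matrix (Fin 2) (Fin 2) ℂ) :
    tensor (fun k => c k • A k) = (∏ k, c k) • tensor A := by
  ext x y
  simp [tensor, Finset.prod_mul_distrib]

theorem star_tensor {n : ℕ} (A : Fin n → Matrix (Fin 2) (Fin 2) ℂ) :
    star (tensor A) = tensor fun k => star (A k) := by
  ext x y
  simp [tensor, Matrix.star_apply]

theorem star_majorana {n : ℕ} (j : Fin (2 * n)) :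
    star (majorana j : Matrix (Basis n) (Basis n) ℂ) = majorana j := by
  have hX : star pauliX = pauliX := by
    ext x y; fin_cases x <;> fin_cases y <;> simp [pauliX, Matrix.star_apply]
  have hY : star pauliY = pauliY := by
    ext x y; fin_cases x <;> fin_cases y <;> simp [pauliY, Matrix.star_apply]
  have hZ : star pauliZ = pauliZ := by
    ext x y; fin_cases x <;> fin_cases y <;> simp [pauliZ, Matrix.star_apply]
  rw [majorana, star_tensor]
  congr 1
  funext k
  split_ifs <;> simp [hX, hY, hZ]

theorem majorana_mul_self {n : ℕ} (j : Fin (2 * n)) :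
    (majorana j : Matrix (Basis n) (Basis n) ℂ) * majorana j = 1 := by
  rw [majorana, tensor_mul, ← tensor_one]
  congr 1
  funext k
  split_ifs <;> simp [pauliX, pauliY, pauliZ, Matrix.one_fin_two]

theorem majorana_mul_comm_of_ne {n : ℕ} {i j : Fin (2 * n)} (hij : i ≠ j) :
    (majorana i : Matrix (Basis n) (Basis n) ℂ) * majorana j = -(majorana j * majorana i) := by
  have hij' : (i : ℕ) ≠ j := fun h => hij (Fin.ext h)
  -- The one-qubit factors anticommute exactly at the smaller of the two sites.
  have hm : min ((i : ℕ) / 2) ((j : ℕ) / 2) < n := by omega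
  have hε : ∏ k : Fin n, (if k = ⟨_, hm⟩ then (-1 : ℂ) else 1) = -1 := by simp
  rw [majorana, majorana, tensor_mul, tensor_mul, ← neg_one_smul ℂ, ← hε, ← tensor_smul]
  congr 1
  funext k
  simp only [Fin.ext_iff]
  split_ifs <;> first
    | (exfalso; omega)
    | simp [pauliX, pauliY, pauliZ]

theorem isCliffordFamily_majorana {n : ℕ} :
    IsCliffordFamily (majorana : Fin (2 * n) → Matrix (Basis n) (Basis n) ℂ) := by
  intro i j
  split_ifs with h
  · subst h
    rw [majorana_mul_self, two_smul, add_sub_cancel_right]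
  · rw [zero_smul, zero_sub, majorana_mul_comm_of_ne h]

/-! ### The commutation index of the quartic Majorana operators -/

/-- The expectation functional `x ↦ Re Tr (x ρ)`. -/
def expectation {n : ℕ} (ρ : Matrix (Basis n) (Basis n) ℂ) :
    Matrix (Basis n) (Basis n) ℂ →ₗ[ℝ] ℝ where
  toFun x := (x * ρ).trace.re
  map_add' x y := by simp [add_mul]
  map_smul' r x := by simp

theorem expectation_apply {n : ℕ} (ρ x : Matrix (Basis n) (Basis n) ℂ) :
    expectation ρ x = (x * ρ).trace.re := rfl

theorem IsState.expectation_one {n : ℕ} {ρ : Matrix (Basis n) (Basis n) ℂ} (hρ : IsState ρ) :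
    expectation ρ 1 = 1 := by
  simp [expectation_apply, hρ.2]

theorem IsState.expectation_star_mul_self_nonneg {n : ℕ} {ρ : Matrix (Basis n) (Basis n) ℂ}
    (hρ : IsState ρ) (x : Matrix (Basis n) (Basis n) ℂ) : 0 ≤ expectation ρ (star x * x) := by
  have h := (hρ.1.mul_mul_conjTranspose_same x).trace_nonneg
  rw [Matrix.trace_mul_comm, ← mul_assoc] at h
  exact (Complex.le_def.1 h).1

theorem IsState.expectation_star {n : ℕ} {ρ : Matrix (Basis n) (Basis n) ℂ}
    (hρ : IsState ρ) (x : Matrix (Basis n) (Basis n) ℂ) :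
    expectation ρ (star x) = expectation ρ x := by
  have h : star x * ρ = (ρ * x)ᴴ := by
    rw [Matrix.conjTranspose_mul, hρ.1.1.eq, Matrix.star_eq_conjTranspose]
  rw [expectation_apply, expectation_apply, h, Matrix.trace_conjTranspose, Matrix.trace_mul_comm]
  simp

theorem majoranaProd_quad {n : ℕ} (I : Quad n) :
    majoranaProd I.1 = majorana (I.1.orderEmbOfFin I.2 0) * majorana (I.1.orderEmbOfFin I.2 1)
      * majorana (I.1.orderEmbOfFin I.2 2) * majorana (I.1.orderEmbOfFin I.2 3) := by
  rw [majoranaProd, ← Finset.listMap_orderEmbOfFin_finRange I.1 I.2]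
  simp [List.finRange_succ, mul_assoc]

/-- The four elements of a quadruple, in increasing order. -/
def quadTuple {n : ℕ} (I : Quad n) :
    Fin (2 * n) × Fin (2 * n) × Fin (2 * n) × Fin (2 * n) :=
  (I.1.orderEmbOfFin I.2 0, I.1.orderEmbOfFin I.2 1, I.1.orderEmbOfFin I.2 2,
    I.1.orderEmbOfFin I.2 3)

theorem quadTuple_injective {n : ℕ} : Function.Injective (quadTuple (n := n)) := by
  intro I J h
  simp only [quadTuple, Prod.mk.injEq] at h
  refine Subtype.ext (Finset.coe_injective ?_)
  rw [← Finset.range_orderEmbOfFin I.1 I.2, ← Finset.range_orderEmbOfFin J.1 J.2]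
  congr 1
  funext k
  fin_cases k
  exacts [h.1, h.2.1, h.2.2.1, h.2.2.2]

theorem IsState.sum_sq_expectation_majoranaProd_le {n : ℕ} {ρ : Matrix (Basis n) (Basis n) ℂ}
    (hρ : IsState ρ) :
    ∑ I : Quad n, expectation ρ (majoranaProd I.1) ^ 2 ≤ 36 * (n : ℝ) ^ 2 := by
  set φ := expectation ρ with hφ
  set γ : Fin (2 * n) → Matrix (Basis n) (Basis n) ℂ := majorana with hγ
  -- Correlations are cut off where two of the last three indices agree, to be antisymmetric.
  set a : Fin (2 * n) → Fin (2 * n) → Fin (2 * n) → Fin (2 * n) → ℝ := fun i j k l =>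
    if j ≠ k ∧ k ≠ l ∧ j ≠ l then φ (γ i * γ j * γ k * γ l) else 0 with ha
  have ha₁ : ∀ i j k l, a i j k l = -a i k j l := fun i j k l => by
    simp only [ha]
    by_cases h : j ≠ k ∧ k ≠ l ∧ j ≠ l
    · rw [if_pos h, if_pos ⟨h.1.symm, h.2.2, h.2.1⟩, mul_assoc (γ i),
        majorana_mul_comm_of_ne h.1]
      simp [hγ, mul_assoc]
    · rw [if_neg h, if_neg (by tauto), neg_zero]
  have ha₂ : ∀ i j k l, a i j k l = -a i j l k := fun i j k l => by
    simp only [ha]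
    by_cases h : j ≠ k ∧ k ≠ l ∧ j ≠ l
    · rw [if_pos h, if_pos ⟨h.2.2, h.2.1.symm, h.1⟩, mul_assoc (γ i * γ j),
        majorana_mul_comm_of_ne h.2.1]
      simp [hγ, mul_assoc]
    · rw [if_neg h, if_neg (by tauto), neg_zero]
  have hmain := sum_sq_quartic_le isCliffordFamily_majorana star_majorana
    hρ.expectation_star_mul_self_nonneg hρ.expectation_one hρ.expectation_star ha₁ ha₂
    (fun i j k l => by
      simp only [ha]
      split_ifs
      exacts [Or.inr rfl, Or.inl rfl])
  have hquad : ∀ I : Quad n, φ (majoranaProd I.1)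
      = a (quadTuple I).1 (quadTuple I).2.1 (quadTuple I).2.2.1 (quadTuple I).2.2.2 := fun I => by
    rw [majoranaProd_quad]
    simp [ha, quadTuple, hγ]
  calc ∑ I : Quad n, φ (majoranaProd I.1) ^ 2
      = ∑ q ∈ Finset.univ.map ⟨_, quadTuple_injective (n := n)⟩,
          a q.1 q.2.1 q.2.2.1 q.2.2.2 ^ 2 := by
        rw [Finset.sum_map]
        exact Finset.sum_congr rfl fun I _ => by rw [hquad]; rfl
    _ ≤ ∑ q : Fin (2 * n) × Fin (2 * n) × Fin (2 * n) × Fin (2 * n),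
          a q.1 q.2.1 q.2.2.1 q.2.2.2 ^ 2 :=
        Finset.sum_le_univ_sum_of_nonneg fun q => sq_nonneg _
    _ = ∑ i, ∑ j, ∑ k, ∑ l, a i j k l ^ 2 := by simp only [Fintype.sum_prod_type]
    _ ≤ 9 * (Fintype.card (Fin (2 * n)) : ℝ) ^ 2 := hmain
    _ = 36 * (n : ℝ) ^ 2 := by
        rw [Fintype.card_fin]
        push_cast
        ring

/-- The mean square expectation of the quartic monomials in a state is `O(1 / n ^ 2)`. For `n = 1`
there are no quadruples, and both the sum and the inverse of the binomial coefficient vanish. -/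
theorem inv_choose_mul_sum_sq_le {n : ℕ} {ρ : Matrix (Basis n) (Basis n) ℂ} (hn : 0 < n)
    (hρ : IsState ρ) :
    ((2 * n).choose 4 : ℝ)⁻¹ * ∑ I : Quad n, expectation ρ (majoranaProd I.1) ^ 2
      ≤ 864 / (n : ℝ) ^ 2 := by
  obtain rfl | hn2 : n = 1 ∨ 2 ≤ n := by omega
  · simp [Nat.choose]
  · have h4 : n ^ 4 ≤ 24 * (2 * n).choose 4 := by
      obtain ⟨m, rfl⟩ := Nat.exists_eq_add_of_le hn2
      have h := Nat.descFactorial_eq_factorial_mul_choose (2 * (2 + m)) 4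
      rw [show Nat.factorial 4 = 24 from rfl] at h
      rw [← h, show 2 * (2 + m) = 2 * m + 4 by ring]
      simp only [Nat.descFactorial_succ, Nat.descFactorial_zero, Nat.sub_zero]
      rw [show 2 * m + 4 - 3 = 2 * m + 1 by omega, show 2 * m + 4 - 2 = 2 * m + 2 by omega,
        show 2 * m + 4 - 1 = 2 * m + 3 by omega]
      ring_nf
      nlinarith
    have h4' : (n : ℝ) ^ 4 ≤ 24 * ((2 * n).choose 4 : ℝ) := by exact_mod_cast h4
    have hn0 : (0 : ℝ) < n := by exact_mod_cast hn
    have hc : (0 : ℝ) < (2 * n).choose 4 := by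
      have : (0 : ℝ) < (n : ℝ) ^ 4 := by positivity
      linarith
    rw [inv_mul_le_iff₀ hc, mul_div_assoc', le_div_iff₀ (by positivity)]
    calc (∑ I : Quad n, expectation ρ (majoranaProd I.1) ^ 2) * (n : ℝ) ^ 2
        ≤ 36 * (n : ℝ) ^ 2 * (n : ℝ) ^ 2 := by
          gcongr
          exact hρ.sum_sq_expectation_majoranaProd_le
      _ ≤ _ := by linarith

/-! ### Gaussian tails for the energy -/

theorem hasSubgaussianMGF_id_gaussianReal : HasSubgaussianMGF id 1 (gaussianReal 0 1) where
  integrable_exp_mul t := integrable_exp_mul_gaussianReal t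
  mgf_le t := by rw [mgf_id_gaussianReal]; simp

theorem measure_pi_gaussianReal_sum_ge_le {ι : Type*} [Fintype ι] (w : ι → ℝ) {v t : ℝ}
    (hw : ∑ i, w i ^ 2 ≤ v) (ht : 0 ≤ t) :
    (Measure.pi fun _ : ι => gaussianReal 0 1) {x | t ≤ ∑ i, x i * w i}
      ≤ ENNReal.ofReal (Real.exp (-t ^ 2 / (2 * v))) := by
  set μ := Measure.pi fun _ : ι => gaussianReal 0 1 with hμ
  have hi : ∀ i ∈ Finset.univ,
      HasSubgaussianMGF (fun x : ι → ℝ => x i * w i) (‖w i‖₊ ^ 2) μ :=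
      fun i _ => by
    have h1 : HasSubgaussianMGF id 1 (μ.map fun x => x i) := by
      exact (measurePreserving_eval (fun _ : ι => gaussianReal 0 1) i).map_eq ▸
        hasSubgaussianMGF_id_gaussianReal
    have hm : AEMeasurable (fun x : ι → ℝ => x i) μ := (measurable_pi_apply i).aemeasurable
    have h2 := (HasSubgaussianMGF.of_map hm h1).const_mul (w i)
    convert h2 using 1
    · funext x
      exact mul_comm _ _
    · exact NNReal.eq ((sq_abs (w i)).trans (mul_one (w i ^ 2)).symm)
  have hind : iIndepFun (fun (i : ι) (x : ι → ℝ) => x i * w i) μ :=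
    iIndepFun_pi (X := fun i y => y * w i) fun i => by fun_prop
  have hsum := HasSubgaussianMGF.sum_of_iIndepFun hind hi
  have hv : 0 ≤ v := (Finset.sum_nonneg fun i _ => sq_nonneg (w i)).trans hw
  -- Raising the variance proxy to `v` before using the tail bound also covers `w = 0`.
  have hsub : HasSubgaussianMGF (fun x : ι → ℝ => ∑ i, x i * w i) ⟨v, hv⟩ μ :=
    ⟨hsum.integrable_exp_mul, fun r => (hsum.mgf_le r).trans <| by
      rw [Real.exp_le_exp]
      simp only [NNReal.coe_sum, NNReal.coe_pow, coe_nnnorm, Real.norm_eq_abs, sq_abs]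
      gcongr
      exact hw⟩
  rw [← ofReal_measureReal]
  exact ENNReal.ofReal_le_ofReal (hsub.measure_ge_le ht)

theorem energy_hamiltonian (n : ℕ) (p : ℝ) (J X : Quad n → ℝ)
    (ρ : Matrix (Basis n) (Basis n) ℂ) :
    energy (hamiltonian n p J X) ρ = ∑ I : Quad n, J I * (X I *
      (-((√((2 * n).choose 4 : ℝ))⁻¹ * (√p)⁻¹) * expectation ρ (majoranaProd I.1))) := by
  set k : ℝ := (√((2 * n).choose 4 : ℝ))⁻¹ * (√p)⁻¹ with hk
  have h : hamiltonian n p J X = -k • ∑ I : Quad n, (J I * X I) • majoranaProd I.1 := by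
    rw [hamiltonian, Complex.I_sq, neg_one_smul, smul_neg, neg_smul, Complex.coe_smul]
    simp only [Complex.coe_smul, hk]
  rw [energy, ← expectation_apply, h, map_smul, map_sum, smul_eq_mul, Finset.mul_sum]
  refine Finset.sum_congr rfl fun I _ => ?_
  rw [map_smul, smul_eq_mul]
  ring

theorem measurable_energy (n : ℕ) (p : ℝ) (ρ : Matrix (Basis n) (Basis n) ℂ) :
    Measurable fun ω : (Quad n → ℝ) × (Quad n → ℝ) => energy (hamiltonian n p ω.1 ω.2) ρ := by
  simp only [energy_hamiltonian]
  fun_prop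

theorem ae_sq_le_one_bernoulliMeasure (p : unitInterval) :
    ∀ᵐ x ∂(bernoulliMeasure (1 : ℝ) 0 p), x ^ 2 ≤ 1 := by
  have hm : MeasurableSet {x : ℝ | ¬ x ^ 2 ≤ 1} :=
    (measurableSet_le (measurable_id.pow_const 2) measurable_const).compl
  rw [ae_iff, bernoulliMeasure_apply p hm]
  norm_num

/-- The energy of a fixed state is sub-Gaussian with variance proxy `864 / (p n ^ 2)`,
conditionally on the indicators `X`: these enter the variance only through `X I ^ 2 ≤ 1`. -/
theorem disorderLaw_energy_ge_le {n : ℕ} (hn : 0 < n) {p : unitInterval} (hp : 0 < (p : ℝ))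
    {ρ : Matrix (Basis n) (Basis n) ℂ} (hρ : IsState ρ) {t : ℝ} (ht : 0 ≤ t) :
    (disorderLaw n p).real {ω | t ≤ energy (hamiltonian n p ω.1 ω.2) ρ}
      ≤ Real.exp (-((p : ℝ) * (n : ℝ) ^ 2 * t ^ 2 / 1728)) := by
  have hn0 : (0 : ℝ) < n := by exact_mod_cast hn
  set k : ℝ := (√((2 * n).choose 4 : ℝ))⁻¹ * (√(p : ℝ))⁻¹ with hk
  set v : ℝ := 864 / (p * (n : ℝ) ^ 2) with hv
  have hvar : ∀ X : Quad n → ℝ, (∀ I, X I ^ 2 ≤ 1) →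
      ∑ I : Quad n, (X I * (-k * expectation ρ (majoranaProd I.1))) ^ 2 ≤ v := fun X hX => by
    have hk2 : k ^ 2 = ((2 * n).choose 4 : ℝ)⁻¹ * (p : ℝ)⁻¹ := by
      rw [hk, mul_pow, inv_pow, inv_pow, Real.sq_sqrt (by positivity), Real.sq_sqrt hp.le]
    calc ∑ I : Quad n, (X I * (-k * expectation ρ (majoranaProd I.1))) ^ 2
        ≤ ∑ I : Quad n, k ^ 2 * expectation ρ (majoranaProd I.1) ^ 2 := by
          refine Finset.sum_le_sum fun I _ => ?_
          rw [mul_pow, mul_pow, neg_sq]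
          exact mul_le_of_le_one_left (by positivity) (hX I)
      _ = (p : ℝ)⁻¹ * (((2 * n).choose 4 : ℝ)⁻¹ *
            ∑ I : Quad n, expectation ρ (majoranaProd I.1) ^ 2) := by
          rw [← Finset.mul_sum, hk2]
          ring
      _ ≤ (p : ℝ)⁻¹ * (864 / (n : ℝ) ^ 2) := by
          gcongr
          exact inv_choose_mul_sum_sq_le hn hρ
      _ = v := by rw [hv]; field_simp
  have hexp : -t ^ 2 / (2 * v) = -((p : ℝ) * (n : ℝ) ^ 2 * t ^ 2 / 1728) := by
    rw [hv]
    field_simp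
    ring
  have hX : ∀ᵐ X ∂(Measure.pi fun _ : Quad n => bernoulliMeasure (1 : ℝ) 0 p),
      ∀ I, X I ^ 2 ≤ 1 := by
    rw [ae_all_iff]
    exact fun I => (measurePreserving_eval (fun _ : Quad n => bernoulliMeasure (1 : ℝ) 0 p)
      I).quasiMeasurePreserving.ae (ae_sq_le_one_bernoulliMeasure p)
  rw [← hexp]
  refine ENNReal.toReal_le_of_le_ofReal (Real.exp_nonneg _) ?_
  rw [disorderLaw, Measure.prod_apply_symm (measurableSet_le measurable_const
    (measurable_energy n p ρ))]
  refine (lintegral_mono_ae (g := fun _ => ENNReal.ofReal (Real.exp (-t ^ 2 / (2 * v)))) ?_).trans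
    (by simp)
  filter_upwards [hX] with X hX
  have h := measure_pi_gaussianReal_sum_ge_le
    (fun I => X I * (-k * expectation ρ (majoranaProd I.1))) (hvar X hX) ht
  simpa only [Set.preimage_ofPred_eq, energy_hamiltonian] using h

end SparseSYK

/-! ### The union bound -/

open SparseSYK

theorem mainTheorem3 :
    ∃ c : ℝ, 0 < c ∧
      ∀ (n : ℕ) (p : unitInterval), 0 < (p : ℝ) →
      ∀ S : Set (Matrix (SparseSYK.Basis n) (SparseSYK.Basis n) ℂ),
        (∀ ρ ∈ S, SparseSYK.IsState ρ) →
      ∀ s : ℝ, 0 ≤ s →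
        1 - Real.exp (-(c * s)) ≤
          (SparseSYK.disorderLaw n p).real
            {ω | ∀ t : ℝ, 0 ≤ t → s ≤ (p : ℝ) * (n : ℝ) ^ 2 * t ^ 2 →
              (∃ ρ ∈ S, t ≤ SparseSYK.energy (SparseSYK.hamiltonian n p ω.1 ω.2) ρ) →
              ENNReal.ofReal (Real.exp (c * ((p : ℝ) * (n : ℝ) ^ 2 * t ^ 2))) ≤
                (S.encard : ℝ≥0∞)} := by
  -- Half of the Gaussian tail exponent is spent on the union bound over `S`.
  refine ⟨1 / 3456, by norm_num, fun n p hp S hS s hs => ?_⟩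
  set c : ℝ := 1 / 3456 with hc
  have hc0 : 0 < c := by norm_num [hc]
  set G := {ω : (Quad n → ℝ) × (Quad n → ℝ) | ∀ t : ℝ, 0 ≤ t →
    s ≤ (p : ℝ) * (n : ℝ) ^ 2 * t ^ 2 →
    (∃ ρ ∈ S, t ≤ energy (hamiltonian n p ω.1 ω.2) ρ) →
    ENNReal.ofReal (Real.exp (c * ((p : ℝ) * (n : ℝ) ^ 2 * t ^ 2))) ≤ (S.encard : ℝ≥0∞)} with hG
  have hprob : IsProbabilityMeasure (disorderLaw n p) := by
    unfold disorderLaw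
    infer_instance
  have huniv : (∀ ω, ω ∈ G) → 1 - Real.exp (-(c * s)) ≤ (disorderLaw n p).real G := fun h => by
    rw [Set.eq_univ_of_forall h, probReal_univ]
    linarith [Real.exp_nonneg (-(c * s))]
  rcases S.finite_or_infinite with hfin | hinf
  swap
  · exact huniv fun ω t _ _ _ => by simp [hinf.encard_eq]
  rcases S.eq_empty_or_nonempty with rfl | hne
  · exact huniv fun ω t _ _ ⟨ρ, hρ, _⟩ => hρ.elim
  rcases Nat.eq_zero_or_pos n with rfl | hn
  · rcases hs.eq_or_lt with rfl | hs
    · simp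
    · exact huniv fun ω t _ h _ => absurd h (by simpa using hs)
  set N := hfin.toFinset.card with hN
  have hN0 : (0 : ℝ) < N := by
    rw [hN]
    exact_mod_cast Finset.card_pos.2 ((Set.Finite.toFinset_nonempty hfin).2 hne)
  have hencard : (S.encard : ℝ≥0∞) = ENNReal.ofReal N := by
    rw [hfin.encard_eq_coe_toFinset_card, ← hN]
    simp
  have hn0 : (0 : ℝ) < n := by exact_mod_cast hn
  have hq : 0 < (p : ℝ) * (n : ℝ) ^ 2 := by positivity
  set q := (p : ℝ) * (n : ℝ) ^ 2 with hqdef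
  -- At an energy below `t₀`, either `s ≤ q * t ^ 2` fails or `N` states suffice.
  set M := max s (Real.log N / c) with hM
  set t₀ := √(M / q) with ht₀
  have hM0 : 0 ≤ M := hs.trans (le_max_left _ _)
  have hqt : q * t₀ ^ 2 = M := by
    rw [ht₀, Real.sq_sqrt (by positivity)]
    field_simp
  set B := ⋃ ρ ∈ hfin.toFinset,
    {ω : (Quad n → ℝ) × (Quad n → ℝ) | t₀ ≤ energy (hamiltonian n p ω.1 ω.2) ρ} with hB
  have hBm : MeasurableSet B := Finset.measurableSet_biUnion _ fun ρ _ =>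
    measurableSet_le measurable_const (measurable_energy n p ρ)
  have hBG : Bᶜ ⊆ G := by
    rintro ω hω t ht hst ⟨ρ, hρ, hE⟩
    have hlt : t < t₀ := by
      by_contra! hle
      exact hω (Set.mem_biUnion (hfin.mem_toFinset.2 hρ) (hle.trans hE))
    have hqM : q * t ^ 2 < M := by
      rw [← hqt]
      gcongr
    have hlog : q * t ^ 2 < Real.log N / c := (lt_max_iff.1 hqM).resolve_left hst.not_gt
    rw [lt_div_iff₀ hc0] at hlog
    rw [hencard]
    refine ENNReal.ofReal_le_ofReal ?_
    rw [← Real.le_log_iff_exp_le hN0]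
    linarith
  have hBle : (disorderLaw n p).real B ≤ Real.exp (-(c * s)) := by
    calc (disorderLaw n p).real B
        ≤ ∑ ρ ∈ hfin.toFinset, (disorderLaw n p).real
            {ω | t₀ ≤ energy (hamiltonian n p ω.1 ω.2) ρ} := measureReal_biUnion_finset_le _ _
      _ ≤ ∑ ρ ∈ hfin.toFinset, Real.exp (-(q * t₀ ^ 2 / 1728)) :=
          Finset.sum_le_sum fun ρ hρ => disorderLaw_energy_ge_le hn hp
            (hS ρ (hfin.mem_toFinset.1 hρ)) (Real.sqrt_nonneg _)
      _ = Real.exp (Real.log N - 2 * (c * M)) := by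
          rw [Finset.sum_const, nsmul_eq_mul, ← hN, hqt, sub_eq_add_neg, Real.exp_add,
            Real.exp_log hN0]
          congr 3
          rw [hc]
          ring
      _ ≤ Real.exp (-(c * s)) := by
          have h1 : Real.log N ≤ c * M := by
            rw [← div_le_iff₀' hc0]
            exact le_max_right _ _
          have h2 : c * s ≤ c * M := by
            gcongr
            exact le_max_left _ _
          rw [Real.exp_le_exp]
          linarith
  calc 1 - Real.exp (-(c * s)) ≤ 1 - (disorderLaw n p).real B := by linarith
    _ = (disorderLaw n p).real Bᶜ := (probReal_compl_eq_one_sub hBm).symm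
    _ ≤ (disorderLaw n p).real G := measureReal_mono hBG
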